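/- Let $k$ be a field, $V$ an $\ell$-dimensional $k$-vector space, and $S=S(V^*)$ the symmetric algebra of its dual. An arrangement in $V$ is a finite set of linear hyperplanes of $V$. For an arrangement $\mathcal A$, choose for each $H\in\mathcal A$ a linear form $\alpha_H\in V^*$ with kernel $H$, and let $$D(\mathcal A)=\{\theta\in\mathrm{Der}_k(S)\mid \theta(\alpha_H)\in\alpha_H S\ \text{for all } H\in\mathcal A\}.$$ A derivation $\theta$ is homogeneous of degree $n$ if $\theta(\alpha)\in S_n$ (the degree-$n$ part of $S$) for every $\alpha\in V^*$. The arrangement $\mathcal A$ is free with exponents $(d_1,\dots,d_\ell)$ if $D(\mathcal A)$ is a free $S$-module with a basis $\theta_1,\dots,\theta_\ell$ such that $\theta_i$ is homogeneous of degree $d_i$ for each $i$. **Theorem (Multiple addition theorem).** Let $\mathcal A'$ be a free arrangement in $V$ with exponents $(d_1,\dots,d_\ell)$, where $\ell\ge 1$ and $d_1\le\cdots\le d_\ell=:d$, and let $p$ be the multiplicity of the highest exponent, i.e. the number of indices $i$ with $d_i=d$. Let $H_1,\dots,H_q$ be linear hyperplanes of $V$ with $H_j\notin\mathcal A'$ for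 all $j$, and put $\mathcal A''_j=\{H\cap H_j\mid H\in\mathcal A'\}$, the restriction of $\mathcal A'\cup\{H_j\}$ to $H_j$. Assume that 1. $X:=H_1\cap\cdots\cap H_q$ has codimension $q$ in $V$; 2. $X\not\subseteq\bigcup_{H\in\mathcal A'}H$; 3. $|\mathcal A'|-|\mathcal A''_j|=d$ for every $1\le j\le q$. Then $q\le p$, and $\mathcal A'\cup\{H_1,\dots,H_q\}$ is free with exponents $(d_1,\dots,d_{\ell-q},(d+1)^q)$, where $(d+1)^q$ means that $d+1$ is repeated $q$ times. -/

import Mathlib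

namespace HyperplaneArrangement

/-- A (linear) hyperplane of `V`: a subspace of codimension one. -/
def IsHyperplane {k V : Type*} [Field k] [AddCommGroup V] [Module k V]
    (H : Submodule k V) : Prop :=
  Module.finrank k (V ⧸ H) = 1

/-- An arrangement in `V`: a finite set of linear hyperplanes. -/
def IsArrangement {k V : Type*} [Field k] [AddCommGroup V] [Module k V]
    (A : Set (Submodule k V)) : Prop :=
  A.Finite ∧ ∀ H ∈ A, IsHyperplane H

/-- The localization `A_X = {H ∈ A | X ⊆ H}`. -/
def localization {k V : Type*} [Field k] [AddCommGroup V] [Module k V]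
    (A : Set (Submodule k V)) (X : Submodule k V) : Set (Submodule k V) :=
  {H | H ∈ A ∧ X ≤ H}

/-- The restriction `A^X = {H ∩ X | H ∈ A \ A_X}`; its members are regarded as subspaces of `V`
contained in `X`. -/
def restriction {k V : Type*} [Field k] [AddCommGroup V] [Module k V]
    (A : Set (Submodule k V)) (X : Submodule k V) : Set (Submodule k V) :=
  (fun H => H ⊓ X) '' (A \ localization A X)

/-- `S = S(V*)`, the symmetric algebra of the dual space. -/
abbrev Sym (k V : Type*) [Field k] [AddCommGroup V] [Module k V] : Type _ :=
  SymmetricAlgebra k (Module.Dual k V)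

/-- A linear form, viewed as an element of `S`. -/
noncomputable abbrev form {k V : Type*} [Field k] [AddCommGroup V] [Module k V]
    (α : Module.Dual k V) : Sym k V :=
  SymmetricAlgebra.ι k (Module.Dual k V) α

/-- The homogeneous part `S_n`: the `k`-span of the products of `n` linear forms
(so `S_0 = k`). -/
noncomputable def homogeneousPart (k V : Type*) [Field k] [AddCommGroup V] [Module k V] (n : ℕ) :
    Submodule k (Sym k V) :=
  LinearMap.range (SymmetricAlgebra.ι k (Module.Dual k V)) ^ n

/-- A derivation of `S` is homogeneous of (polynomial) degree `n` if it maps linear forms to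
elements of `S_n`, i.e. if its coefficients in the derivations `∂/∂x_i` lie in `S_n`. -/
def IsHomogeneousOfDegree {k V : Type*} [Field k] [AddCommGroup V] [Module k V]
    (θ : Derivation k (Sym k V) (Sym k V)) (n : ℕ) : Prop :=
  ∀ α : Module.Dual k V, θ (form α) ∈ homogeneousPart k V n

/-- The module `D(A)` of logarithmic derivations: all `θ ∈ Der S` with `θ(α_H) ∈ α_H S` for
`H ∈ A`, where `α_H` is a defining linear form of `H` (the condition does not depend on its choice,
and is imposed here for every choice). -/
noncomputable def logDer {k V : Type*} [Field k] [AddCommGroup V] [Module k V]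
    (A : Set (Submodule k V)) : Submodule (Sym k V) (Derivation k (Sym k V) (Sym k V)) where
  carrier := {θ | ∀ H ∈ A, ∀ α : Module.Dual k V, LinearMap.ker α = H →
    θ (form α) ∈ Ideal.span {form α}}
  add_mem' := fun h₁ h₂ H hH α hα => Ideal.add_mem _ (h₁ H hH α hα) (h₂ H hH α hα)
  zero_mem' := fun _ _ _ _ => Ideal.zero_mem _
  smul_mem' := fun c _ h H hH α hα => Ideal.mul_mem_left _ c (h H hH α hα)

/-- `A` is free with exponents `(e_1, …, e_ℓ)`: `D(A)` is a free `S`-module with a homogeneous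
basis `θ_1, …, θ_ℓ` such that `deg θ_i = e_i`. -/
def IsFreeWithExponents {k V : Type*} [Field k] [AddCommGroup V] [Module k V]
    (A : Set (Submodule k V)) {l : ℕ} (e : Fin l → ℕ) : Prop :=
  ∃ θ : Module.Basis (Fin l) (Sym k V) (logDer A),
    ∀ i, IsHomogeneousOfDegree (θ i : Derivation k (Sym k V) (Sym k V)) (e i)

end HyperplaneArrangement

/-! Choose z in X outside every hyperplane of A'. The values at z of D(A') fill the whole tangent
space, because Q∂_v is logarithmic for the product Q of the defining forms, and Q(z) ≠ 0
(`span_evalAt_eq_top`). Let α_j define H_j and let θ_i be a homogeneous basis of D(A'). Since X has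
codimension q, the matrix C with entries θ_i(α_j)(z) has rank q.

Terao's polynomial b_j, of degree |A'| - |A''_j| = d, satisfies θ(α_j) ∈ (α_j, b_j) for all θ in
D(A') (`exists_homogeneous_restrictKer_dvd`). So θ_i(α_j) is divisible by α_j if deg θ_i < d, and is
a scalar multiple of b_j modulo α_j if deg θ_i = d. As α_j(z) = 0, the rows of C of degree below d
vanish, whence q ≤ p, and the scalars in degree d are the entries of C divided by b_j(z).

A scalar change of basis among the θ_i of degree d turns q rows of C into an identity block and the
others into zero (`exists_basis_change`). Multiplying the q corresponding θ_i by the α_j gives a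
basis of the new module: if a combination with coefficients f_i is logarithmic along H_j, then α_j
divides f_{u j} b_j, hence f_{u j}, as α_j is prime and does not divide b_j
(`exists_basis_logDer_union`). -/

namespace SymmetricAlgebra

/-! ### Symmetric algebras: divisibility, functoriality, degree, derivations. -/

variable {k M N : Type*} [Field k] [AddCommGroup M] [Module k M] [AddCommGroup N] [Module k N]

/-- A nonzero vector is a prime element of the symmetric algebra. -/
theorem prime_ι {m : M} (hm : m ≠ 0) : Prime (ι k M m) := by
  have hs : LinearIndepOn k id ({m} : Set M) := by
    simpa using hm
  let b := Module.Basis.extend hs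
  have hmem : m ∈ hs.extend (Set.subset_univ _) := hs.subset_extend _ rfl
  have hb : b ⟨m, hmem⟩ = m := by simp [b]
  have hX := equivMvPolynomial_ι_apply b ⟨m, hmem⟩
  rw [hb] at hX
  rw [← MulEquiv.prime_iff (equivMvPolynomial b), hX]
  exact MvPolynomial.X_prime

/-- A functional killing `m` but not `n` extends to an algebra map to `k`, which would violate the
divisibility. -/
theorem mem_span_of_ι_dvd_ι {m n : M} (h : ι k M m ∣ ι k M n) : n ∈ Submodule.span k {m} := by
  by_contra hn
  obtain ⟨f, hf, hle⟩ := Submodule.exists_le_ker_of_notMem hn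
  have hfm : f m = 0 := hle (Submodule.mem_span_singleton_self m)
  have := map_dvd (lift f) h
  rw [lift_ι_apply, lift_ι_apply, hfm, zero_dvd_iff] at this
  exact hf this

instance instUniqueFactorizationMonoid : UniqueFactorizationMonoid (SymmetricAlgebra k M) :=
  (equivMvPolynomial (Module.Basis.ofVectorSpace k M)).symm.toMulEquiv.uniqueFactorizationMonoid
    inferInstance

/-- The algebra map between symmetric algebras induced by a linear map. -/
noncomputable def mapAlgHom (r : M →ₗ[k] N) : SymmetricAlgebra k M →ₐ[k] SymmetricAlgebra k N :=
  lift (ι k N ∘ₗ r)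

@[simp]
theorem mapAlgHom_ι (r : M →ₗ[k] N) (m : M) : mapAlgHom r (ι k M m) = ι k N (r m) := by
  simp [mapAlgHom]

/-- The kernel of a surjection `S(M) → S(N)` induced by a linear map whose kernel is spanned by
`m` is generated by `m`. -/
theorem ι_dvd_of_mapAlgHom_eq_zero {r : M →ₗ[k] N} (hr : Function.Surjective r) {m : M}
    (hm : LinearMap.ker r ≤ Submodule.span k {m}) {f : SymmetricAlgebra k M}
    (hf : mapAlgHom r f = 0) : ι k M m ∣ f := by
  -- For a linear section `s`, each `s (r x) - x` lies in the kernel of `r`, so the composite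
  -- induced on S(M) is the identity modulo `m`.
  obtain ⟨s, hs⟩ := r.exists_rightInverse_of_surjective (LinearMap.range_eq_top.2 hr)
  let I : Ideal (SymmetricAlgebra k M) := Ideal.span {ι k M m}
  have key : (Ideal.Quotient.mkₐ k I).comp ((mapAlgHom s).comp (mapAlgHom r)) =
      Ideal.Quotient.mkₐ k I := by
    refine algHom_ext (LinearMap.ext fun x => ?_)
    change Ideal.Quotient.mk I (mapAlgHom s (mapAlgHom r (ι k M x))) =
      Ideal.Quotient.mk I (ι k M x)
    rw [Ideal.Quotient.eq, mapAlgHom_ι, mapAlgHom_ι, ← map_sub]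
    have hx : s (r x) - x ∈ Submodule.span k {m} := hm <| by
      simp [show r (s (r x)) = r x from LinearMap.congr_fun hs (r x)]
    obtain ⟨c, hc⟩ := Submodule.mem_span_singleton.1 hx
    rw [← hc, map_smul, Algebra.smul_def]
    exact I.mul_mem_left _ (Ideal.mem_span_singleton_self _)
  have := DFunLike.congr_fun key f
  simp only [AlgHom.comp_apply, hf, map_zero] at this
  rw [← Ideal.mem_span_singleton]
  exact Ideal.Quotient.eq_zero_iff_mem.1 this.symm

theorem mapAlgHom_mem_range_ι_pow (r : M →ₗ[k] N) {n : ℕ} {f : SymmetricAlgebra k M}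
    (hf : f ∈ LinearMap.range (ι k M) ^ n) : mapAlgHom r f ∈ LinearMap.range (ι k N) ^ n := by
  have h := Submodule.mem_map_of_mem (f := (mapAlgHom r).toLinearMap) hf
  rw [Submodule.map_pow] at h
  refine pow_le_pow_left' (M := Submodule k _) ?_ n h
  rintro _ ⟨_, ⟨m, rfl⟩, rfl⟩
  exact ⟨r m, by simp⟩

theorem isHomogeneous_equivMvPolynomial {κ : Type*} (b : Module.Basis κ k M) {n : ℕ}
    {f : SymmetricAlgebra k M} (hf : f ∈ LinearMap.range (ι k M) ^ n) :
    (equivMvPolynomial b f).IsHomogeneous n := by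
  have h := Submodule.mem_map_of_mem (f := (equivMvPolynomial b).toAlgHom.toLinearMap) hf
  rw [Submodule.map_pow] at h
  rw [← MvPolynomial.mem_homogeneousSubmodule, ← MvPolynomial.homogeneousSubmodule_one_pow]
  refine pow_le_pow_left' (M := Submodule k _) ?_ n h
  rintro _ ⟨_, ⟨m, rfl⟩, rfl⟩
  have hm : m ∈ Submodule.span k (Set.range b) := b.mem_span m
  induction hm using Submodule.span_induction with
  | mem x hx => obtain ⟨i, rfl⟩ := hx; simpa using MvPolynomial.isHomogeneous_X k i
  | zero => simp
  | add x y _ _ hx hy => simpa only [map_add] using add_mem hx hy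
  | smul c x _ hx => simpa only [map_smul] using Submodule.smul_mem _ c hx

/-- A homogeneous element divisible by a homogeneous element of larger degree vanishes. -/
theorem eq_zero_of_dvd_of_lt {n d : ℕ} {f b : SymmetricAlgebra k M}
    (hf : f ∈ LinearMap.range (ι k M) ^ n) (hb : b ∈ LinearMap.range (ι k M) ^ d)
    (h : b ∣ f) (hnd : n < d) : f = 0 := by
  by_contra hf0
  let E := equivMvPolynomial (Module.Basis.ofVectorSpace k M)
  obtain ⟨g, rfl⟩ := h
  have h0 := (map_ne_zero_iff E E.injective).2 hf0
  have h1 := (isHomogeneous_equivMvPolynomial _ hf).totalDegree h0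
  rw [map_mul] at h0 h1
  rw [MvPolynomial.totalDegree_mul_of_isDomain (left_ne_zero_of_mul h0) (right_ne_zero_of_mul h0),
    (isHomogeneous_equivMvPolynomial _ hb).totalDegree (left_ne_zero_of_mul h0)] at h1
  omega

/-- A homogeneous element divisible by a homogeneous element of the same degree is a scalar
multiple of it. -/
theorem exists_eq_smul_of_dvd {d : ℕ} {f b : SymmetricAlgebra k M}
    (hf : f ∈ LinearMap.range (ι k M) ^ d) (hb : b ∈ LinearMap.range (ι k M) ^ d)
    (h : b ∣ f) : ∃ c : k, f = c • b := by
  rcases eq_or_ne f 0 with rfl | hf0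
  · exact ⟨0, by simp⟩
  let E := equivMvPolynomial (Module.Basis.ofVectorSpace k M)
  obtain ⟨g, rfl⟩ := h
  have h0 := (map_ne_zero_iff E E.injective).2 hf0
  have h1 := (isHomogeneous_equivMvPolynomial _ hf).totalDegree h0
  rw [map_mul] at h0 h1
  rw [MvPolynomial.totalDegree_mul_of_isDomain (left_ne_zero_of_mul h0) (right_ne_zero_of_mul h0),
    (isHomogeneous_equivMvPolynomial _ hb).totalDegree (left_ne_zero_of_mul h0)] at h1
  have h2 := MvPolynomial.totalDegree_eq_zero_iff_eq_C.1 (show (E g).totalDegree = 0 by omega)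
  refine ⟨MvPolynomial.coeff 0 (E g), E.injective ?_⟩
  rw [map_mul, map_smul, mul_comm, ← MvPolynomial.C_mul', ← h2]

/-- The derivation of the symmetric algebra extending a linear functional. -/
noncomputable def derivationOfDual (φ : M →ₗ[k] k) :
    Derivation k (SymmetricAlgebra k M) (SymmetricAlgebra k M) :=
  -- Derivations are the ε-parts of algebra maps S → S[ε] lifting the identity; this one sends m to
  -- m + ε φ(m).
  let F : SymmetricAlgebra k M →ₐ[k] TrivSqZeroExt (SymmetricAlgebra k M) (SymmetricAlgebra k M) :=
    lift ((TrivSqZeroExt.inlAlgHom k _ _).toLinearMap ∘ₗ ι k M +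
      (TrivSqZeroExt.inrHom _ _).restrictScalars k ∘ₗ Algebra.linearMap k _ ∘ₗ φ)
  have hF : ∀ f, (F f).fst = f := fun f => by
    have : (TrivSqZeroExt.fstHom k _ _).comp F = AlgHom.id k _ :=
      algHom_ext (LinearMap.ext fun m => by simp [F])
    exact DFunLike.congr_fun this f
  Derivation.mk' ((TrivSqZeroExt.sndHom _ _).restrictScalars k ∘ₗ F.toLinearMap) fun a b => by
    simp [TrivSqZeroExt.snd_mul, hF, mul_comm]

@[simp]
theorem derivationOfDual_ι (φ : M →ₗ[k] k) (m : M) :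
    derivationOfDual φ (ι k M m) = algebraMap k _ (φ m) := by
  simp [derivationOfDual, Algebra.algebraMap_eq_smul_one]

end SymmetricAlgebra

namespace HyperplaneArrangement

/-! ### Defining forms of hyperplanes. -/

variable {k V : Type*} [Field k] [AddCommGroup V] [Module k V]

theorem form_add (α β : Module.Dual k V) : form (α + β) = form α + form β :=
  map_add _ _ _

theorem form_smul (c : k) (α : Module.Dual k V) : form (c • α) = c • form α :=
  map_smul _ _ _

theorem IsHyperplane.exists_ker_eq {H : Submodule k V} (hH : IsHyperplane H) :
    ∃ α : Module.Dual k V, α ≠ 0 ∧ LinearMap.ker α = H := by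
  have hfin : Module.Finite k (V ⧸ H) := Module.finite_of_finrank_pos (by rw [hH]; exact one_pos)
  let E := LinearEquiv.ofFinrankEq (V ⧸ H) k (by rw [hH, Module.finrank_self])
  have hker : LinearMap.ker (E.toLinearMap ∘ₗ H.mkQ) = H := by
    rw [LinearEquiv.ker_comp, Submodule.ker_mkQ]
  refine ⟨E.toLinearMap ∘ₗ H.mkQ, fun h0 => ?_, hker⟩
  rw [h0, LinearMap.ker_zero] at hker
  have : Subsingleton (V ⧸ H) := Submodule.Quotient.subsingleton_iff.2 hker.symm
  have h1 : Module.finrank k (V ⧸ H) = 1 := hH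
  rw [Module.finrank_zero_of_subsingleton] at h1
  exact zero_ne_one h1

theorem exists_eq_smul_of_ker_le {α β : Module.Dual k V}
    (h : LinearMap.ker α ≤ LinearMap.ker β) : ∃ c : k, β = c • α := by
  have := mem_span_of_iInf_ker_le_ker (L := fun _ : Unit => α) (K := β) (by simpa using h)
  rw [Set.range_const] at this
  obtain ⟨c, hc⟩ := Submodule.mem_span_singleton.1 this
  exact ⟨c, hc.symm⟩

theorem ker_eq_of_ker_le {α β : Module.Dual k V} (hβ : β ≠ 0)
    (h : LinearMap.ker α ≤ LinearMap.ker β) : LinearMap.ker α = LinearMap.ker β := by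
  obtain ⟨c, rfl⟩ := exists_eq_smul_of_ker_le h
  exact (LinearMap.ker_smul α c fun hc => hβ (by rw [hc, zero_smul])).symm

theorem isRelPrime_form {α β : Module.Dual k V} (hα : α ≠ 0) (hβ : β ≠ 0)
    (h : LinearMap.ker α ≠ LinearMap.ker β) : IsRelPrime (form α) (form β) := by
  rw [(SymmetricAlgebra.prime_ι hα).irreducible.isRelPrime_iff_not_dvd]
  intro hdvd
  obtain ⟨c, rfl⟩ := Submodule.mem_span_singleton.1 (SymmetricAlgebra.mem_span_of_ι_dvd_ι hdvd)
  exact h (ker_eq_of_ker_le hβ fun x hx => by simp_all)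

/-- It suffices to test membership in `D(A)` on one defining form of each hyperplane. -/
theorem form_dvd_of_ker_eq {θ : Derivation k (Sym k V) (Sym k V)} {α β : Module.Dual k V}
    (h : LinearMap.ker β = LinearMap.ker α) (hα : α ≠ 0) (hθ : form α ∣ θ (form α)) :
    form β ∣ θ (form β) := by
  obtain ⟨c, rfl⟩ := exists_eq_smul_of_ker_le h.le
  have hc : c ≠ 0 := fun hc => hα (by rw [hc, zero_smul])
  have hdvd : form β ∣ form (c • β) := by
    rw [form_smul, Algebra.smul_def]; exact dvd_mul_left _ _
  have := hdvd.trans hθ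
  rw [form_smul, Derivation.map_smul] at this
  have h2 := this.mul_left (algebraMap k (Sym k V) c⁻¹)
  rwa [← Algebra.smul_def, inv_smul_smul₀ hc] at h2

theorem form_dvd_of_mem_logDer {A : Set (Submodule k V)} {θ : Derivation k (Sym k V) (Sym k V)}
    (hθ : θ ∈ logDer A) {α : Module.Dual k V} (hα : LinearMap.ker α ∈ A) :
    form α ∣ θ (form α) :=
  Ideal.mem_span_singleton.1 (hθ _ hα α rfl)

/-! ### Restriction to a hyperplane and Terao's polynomial. -/

/-- Restriction of polynomial functions to the hyperplane `ker α`. -/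
noncomputable abbrev restrictKer (α : Module.Dual k V) :
    Sym k V →ₐ[k] Sym k (LinearMap.ker α) :=
  SymmetricAlgebra.mapAlgHom (LinearMap.ker α).dualRestrict

theorem dualRestrict_ker_eq_zero {α β : Module.Dual k V}
    (h : (LinearMap.ker α).dualRestrict β = 0) : ∃ c : k, β = c • α :=
  exists_eq_smul_of_ker_le fun x hx => LinearMap.congr_fun h ⟨x, hx⟩

theorem form_dvd_of_restrictKer_eq_zero {α : Module.Dual k V} {f : Sym k V}
    (hf : restrictKer α f = 0) : form α ∣ f := by
  refine SymmetricAlgebra.ι_dvd_of_mapAlgHom_eq_zero Subspace.dualRestrict_surjective ?_ hf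
  intro β hβ
  obtain ⟨c, rfl⟩ := dualRestrict_ker_eq_zero hβ
  exact Submodule.smul_mem _ _ (Submodule.mem_span_singleton_self _)

theorem restrictKer_form_self (α : Module.Dual k V) : restrictKer α (form α) = 0 := by
  have : (LinearMap.ker α).dualRestrict α = 0 := by ext x; simp
  rw [SymmetricAlgebra.mapAlgHom_ι, this, map_zero]

theorem dualRestrict_ker_ne_zero {α β : Module.Dual k V} (hβ : β ≠ 0)
    (h : LinearMap.ker β ≠ LinearMap.ker α) : (LinearMap.ker α).dualRestrict β ≠ 0 := by
  intro h0
  exact h (ker_eq_of_ker_le hβ fun x hx => LinearMap.congr_fun h0 ⟨x, hx⟩).symm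

/-- If the hyperplanes in `F` have the same trace on `ker α`, then for a logarithmic derivation
`θ`, the restriction of `θ α` to `ker α` vanishes along the trace to order `|F| - 1`. -/
theorem form_pow_dvd_restrictKer {A : Set (Submodule k V)} {α : Module.Dual k V}
    (hαA : LinearMap.ker α ∉ A) {θ : Derivation k (Sym k V) (Sym k V)} (hθ : θ ∈ logDer A)
    {F : Finset (Submodule k V)} (hF : ∀ K ∈ F, K ∈ A)
    {β : Submodule k V → Module.Dual k V} (hβ : ∀ K ∈ F, β K ≠ 0 ∧ LinearMap.ker (β K) = K)
    {K₀ : Submodule k V} (hK₀ : K₀ ∈ F)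
    (hsame : ∀ K ∈ F, K ⊓ LinearMap.ker α = K₀ ⊓ LinearMap.ker α) :
    restrictKer α (form (β K₀)) ^ (F.card - 1) ∣ restrictKer α (θ (form α)) := by
  have hne : ∀ K ∈ F, (LinearMap.ker α).dualRestrict (β K) ≠ 0 := fun K hK =>
    dualRestrict_ker_ne_zero (hβ K hK).1 fun h => hαA (by
      rw [← h, (hβ K hK).2]; exact hF K hK)
  have hlin : ∀ K ∈ F, ∃ u c : k, u ≠ 0 ∧ β K = u • β K₀ + c • α := by
    intro K hK
    obtain ⟨u, hu⟩ := exists_eq_smul_of_ker_le (α := (LinearMap.ker α).dualRestrict (β K₀))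
      (β := (LinearMap.ker α).dualRestrict (β K)) (by
        rintro ⟨x, hx⟩ hx0
        have h1 : x ∈ K₀ ⊓ LinearMap.ker α := ⟨by rw [← (hβ K₀ hK₀).2]; exact hx0, hx⟩
        rw [← hsame K hK] at h1
        have h2 : x ∈ LinearMap.ker (β K) := by rw [(hβ K hK).2]; exact h1.1
        exact h2)
    obtain ⟨c, hc⟩ := dualRestrict_ker_eq_zero (α := α) (β := β K - u • β K₀)
      (by rw [map_sub, map_smul, hu, sub_self])
    refine ⟨u, c, fun h0 => hne K hK (by rw [hu, h0, zero_smul]), ?_⟩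
    rw [← hc]; abel
  -- This 2×2 determinant changes only by the factor `u` when `β K₀` is replaced by `β K = u • β K₀
  -- + c • α`, so every `β K` divides the same element.
  have hW : ∀ K ∈ F, form (β K) ∣ form (β K₀) * θ (form α) - form α * θ (form (β K₀)) := by
    intro K hK
    obtain ⟨u, c, hu, huc⟩ := hlin K hK
    have h1 : form (β K) ∣ θ (form (β K)) :=
      form_dvd_of_mem_logDer hθ ((hβ K hK).2.symm ▸ hF K hK)
    have h2 : form (β K) ∣ form (β K) * θ (form α) - form α * θ (form (β K)) :=
      dvd_sub (dvd_mul_right _ _) (h1.mul_left _)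
    have h3 : form (β K) * θ (form α) - form α * θ (form (β K)) =
        u • (form (β K₀) * θ (form α) - form α * θ (form (β K₀))) := by
      rw [huc]
      rw [form_add, form_smul, form_smul, map_add, Derivation.map_smul, Derivation.map_smul]
      simp only [Algebra.smul_def]
      ring
    rw [h3] at h2
    have h4 := h2.mul_left (algebraMap k (Sym k V) u⁻¹)
    rwa [← Algebra.smul_def, inv_smul_smul₀ hu] at h4
  have hprod : ∏ K ∈ F, form (β K) ∣ form (β K₀) * θ (form α) - form α * θ (form (β K₀)) := by
    refine Finset.prod_dvd_of_isRelPrime (fun K hK L hL hKL => ?_) hW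
    refine isRelPrime_form (hβ K hK).1 (hβ L hL).1 ?_
    rwa [(hβ K hK).2, (hβ L hL).2]
  -- On `ker α` the second term dies and each `β K` becomes a unit multiple of `β K₀`; cancelling
  -- one factor gives the exponent `F.card - 1`.
  have hres := map_dvd (restrictKer α) hprod
  rw [map_sub, map_mul, map_mul, restrictKer_form_self, zero_mul, sub_zero, map_prod] at hres
  have hpow : restrictKer α (form (β K₀)) ^ F.card ∣ ∏ K ∈ F, restrictKer α (form (β K)) := by
    rw [← Finset.prod_const]
    refine Finset.prod_dvd_prod_of_dvd _ _ fun K hK => ?_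
    obtain ⟨u, c, hu, huc⟩ := hlin K hK
    rw [huc, form_add, form_smul, form_smul, map_add, map_smul, map_smul,
      restrictKer_form_self, smul_zero, add_zero, Algebra.smul_def]
    exact dvd_mul_left _ _
  have hfin := hpow.trans hres
  have hpos : 0 < F.card := Finset.card_pos.2 ⟨K₀, hK₀⟩
  rw [← Nat.sub_add_cancel hpos, pow_succ'] at hfin
  refine (mul_dvd_mul_iff_left ?_).1 hfin
  rw [SymmetricAlgebra.mapAlgHom_ι]
  exact (SymmetricAlgebra.prime_ι (hne K₀ hK₀)).ne_zero

theorem prod_mem_homogeneousPart {σ : Type*} (s : Finset σ) {f : σ → Sym k V} {n : σ → ℕ}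
    (h : ∀ i ∈ s, f i ∈ homogeneousPart k V (n i)) :
    ∏ i ∈ s, f i ∈ homogeneousPart k V (∑ i ∈ s, n i) := by
  classical
  induction s using Finset.induction_on with
  | empty => simp [homogeneousPart]
  | insert a s ha ih =>
    rw [Finset.prod_insert ha, Finset.sum_insert ha]
    unfold homogeneousPart at *
    rw [pow_add]
    exact Submodule.mul_mem_mul (h _ (Finset.mem_insert_self _ _))
      (ih fun i hi => h i (Finset.mem_insert_of_mem hi))

/-- Terao's polynomial: for a hyperplane `ker α` not in `A` there is a homogeneous polynomial `b`
of degree `|A| - |A''|` such that `θ α ∈ (α, b)` for all `θ ∈ D(A)`. -/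
theorem exists_homogeneous_restrictKer_dvd {A : Set (Submodule k V)} (hA : IsArrangement A)
    {α : Module.Dual k V} (hαA : LinearMap.ker α ∉ A) :
    ∃ b ∈ homogeneousPart k V (A.ncard - ((fun K => K ⊓ LinearMap.ker α) '' A).ncard),
      ∀ θ ∈ logDer A, restrictKer α b ∣ restrictKer α (θ (form α)) := by
  classical
  obtain ⟨F, rfl⟩ := hA.1.exists_finset_coe
  have hex : ∀ K : Submodule k V, ∃ β : Module.Dual k V,
      K ∈ F → β ≠ 0 ∧ LinearMap.ker β = K := fun K => by
    by_cases hK : K ∈ F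
    · obtain ⟨β, hβ⟩ := (hA.2 K hK).exists_ker_eq
      exact ⟨β, fun _ => hβ⟩
    · exact ⟨0, fun h => absurd h hK⟩
  choose β hβ using hex
  let g : Submodule k V → Submodule k V := fun K => K ⊓ LinearMap.ker α
  have hsec : ∀ X : Submodule k V, ∃ K, X ∈ F.image g → K ∈ F ∧ g K = X := fun X => by
    by_cases hX : X ∈ F.image g
    · obtain ⟨K, hK⟩ := Finset.mem_image.1 hX
      exact ⟨K, fun _ => hK⟩
    · exact ⟨⊥, fun h => absurd h hX⟩
  choose κ hκ using hsec
  -- Each trace has a nonempty fibre, so these exponents add up to |A| - |A''|.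
  let m : Submodule k V → ℕ := fun X => (F.filter fun K => g K = X).card - 1
  refine ⟨∏ X ∈ F.image g, form (β (κ X)) ^ m X, ?_, fun θ hθ => ?_⟩
  · have hdeg : (F : Set (Submodule k V)).ncard - (g '' (F : Set (Submodule k V))).ncard =
        ∑ X ∈ F.image g, m X := by
      rw [Finset.sum_tsub_distrib]
      · rw [← Finset.coe_image, Set.ncard_coe_finset, Set.ncard_coe_finset,
          Finset.card_eq_sum_card_image g F]
        simp
      · intro X hX
        exact Finset.card_pos.2 ⟨κ X, Finset.mem_filter.2 (hκ X hX)⟩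
    rw [hdeg]
    exact prod_mem_homogeneousPart _ fun X _ => Submodule.pow_mem_pow _ (LinearMap.mem_range_self _ _) _
  · rw [map_prod]
    refine Finset.prod_dvd_of_isRelPrime (fun X hX Y hY hXY => ?_) fun X hX => ?_
    · obtain ⟨hXF, hXg⟩ := hκ X hX
      obtain ⟨hYF, hYg⟩ := hκ Y hY
      have hne : ∀ K ∈ F, (LinearMap.ker α).dualRestrict (β K) ≠ 0 := fun K hK =>
        dualRestrict_ker_ne_zero (hβ K hK).1 fun h => hαA (by
          rw [← h, (hβ K hK).2]; exact hK)
      have htrace : ∀ K ∈ F, (LinearMap.ker ((LinearMap.ker α).dualRestrict (β K))).map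
          (LinearMap.ker α).subtype = g K := fun K hK => by
        change _ = K ⊓ LinearMap.ker α
        conv_rhs => rw [← (hβ K hK).2]
        ext x
        simp [and_comm]
      simp only [Function.onFun, map_pow, SymmetricAlgebra.mapAlgHom_ι]
      refine IsRelPrime.pow (isRelPrime_form (hne _ hXF) (hne _ hYF) fun h => hXY ?_)
      rw [← hXg, ← hYg, ← htrace _ hXF, ← htrace _ hYF, h]
    · obtain ⟨hXF, hXg⟩ := hκ X hX
      rw [map_pow]
      refine form_pow_dvd_restrictKer hαA hθ (F := F.filter fun K => g K = X)
        (fun K hK => (Finset.mem_filter.1 hK).1) (fun K hK => hβ K (Finset.mem_filter.1 hK).1)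
        (Finset.mem_filter.2 ⟨hXF, hXg⟩) fun K hK => ?_
      exact (Finset.mem_filter.1 hK).2.trans hXg.symm

/-- No member of `A` contains `ker α`, since nested hyperplanes coincide; the localization is
therefore `ker α` alone. -/
theorem restriction_union_singleton {A : Set (Submodule k V)} (hA : IsArrangement A)
    {α : Module.Dual k V} (hαA : LinearMap.ker α ∉ A) :
    restriction (A ∪ {LinearMap.ker α}) (LinearMap.ker α) =
      (fun K => K ⊓ LinearMap.ker α) '' A := by
  have hsdiff : (A ∪ {LinearMap.ker α}) \
      localization (A ∪ {LinearMap.ker α}) (LinearMap.ker α) = A := by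
    ext K
    constructor
    · rintro ⟨hK | rfl, hloc⟩
      · exact hK
      · exact absurd ⟨Or.inr rfl, le_rfl⟩ hloc
    · refine fun hK => ⟨Or.inl hK, fun hloc => ?_⟩
      obtain ⟨β, hβ, rfl⟩ := (hA.2 K hK).exists_ker_eq
      exact hαA (ker_eq_of_ker_le hβ hloc.2 ▸ hK)
  rw [restriction, hsdiff]

/-- For a homogeneous logarithmic derivation `θ` of degree at most `d = |A| - |A''|`, the
polynomial `θ α` is divisible by `α` if the degree is smaller than `d`, and is modulo `α` a scalar
multiple of a fixed polynomial `b` if the degree is `d`. -/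
theorem exists_form_dvd_sub_smul {A : Set (Submodule k V)} (hA : IsArrangement A)
    {α : Module.Dual k V} (hαA : LinearMap.ker α ∉ A) {d : ℕ}
    (hd : (A.ncard : ℤ) -
      ((restriction (A ∪ {LinearMap.ker α}) (LinearMap.ker α)).ncard : ℤ) = d) :
    ∃ b : Sym k V, ∀ θ ∈ logDer A, ∀ n, IsHomogeneousOfDegree θ n →
      (n < d → form α ∣ θ (form α)) ∧ (n = d → ∃ c : k, form α ∣ θ (form α) - c • b) := by
  obtain ⟨b, hb, hdvd⟩ := exists_homogeneous_restrictKer_dvd hA hαA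
  rw [restriction_union_singleton hA hαA] at hd
  rw [show A.ncard - ((fun K => K ⊓ LinearMap.ker α) '' A).ncard = d by omega] at hb
  have hb' := SymmetricAlgebra.mapAlgHom_mem_range_ι_pow (LinearMap.ker α).dualRestrict hb
  refine ⟨b, fun θ hθ n hn => ?_⟩
  have hθ' := SymmetricAlgebra.mapAlgHom_mem_range_ι_pow (LinearMap.ker α).dualRestrict (hn α)
  constructor
  · intro hnd
    exact form_dvd_of_restrictKer_eq_zero
      (SymmetricAlgebra.eq_zero_of_dvd_of_lt hθ' hb' (hdvd θ hθ) hnd)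
  · rintro rfl
    obtain ⟨c, hc⟩ := SymmetricAlgebra.exists_eq_smul_of_dvd hθ' hb' (hdvd θ hθ)
    refine ⟨c, form_dvd_of_restrictKer_eq_zero ?_⟩
    rw [map_sub, map_smul, sub_eq_zero]
    exact hc

/-! ### Values of logarithmic derivations at a point. -/

/-- Evaluation of polynomial functions at a point. -/
noncomputable def evalAt (z : V) : Sym k V →ₐ[k] k :=
  SymmetricAlgebra.lift (Module.Dual.eval k V z)

@[simp]
theorem evalAt_form (z : V) (α : Module.Dual k V) : evalAt z (form α) = α z := by
  simp [evalAt]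

/-- Off the arrangement, the values of logarithmic derivations fill the tangent space. -/
theorem span_evalAt_eq_top {A : Set (Submodule k V)} (hA : IsArrangement A) {z : V}
    (hz : ∀ K ∈ A, z ∉ K) {ι κ : Type*} [Fintype ι]
    (θ : Module.Basis ι (Sym k V) (logDer A)) {α : κ → Module.Dual k V}
    (hα : Function.Surjective (LinearMap.pi α)) :
    Submodule.span k (Set.range fun i j =>
      evalAt z ((θ i : Derivation k (Sym k V) (Sym k V)) (form (α j)))) = ⊤ := by
  obtain ⟨F, rfl⟩ := hA.1.exists_finset_coe
  choose! β hβ using fun K (hK : K ∈ F) => (hA.2 K hK).exists_ker_eq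
  let Q : Sym k V := ∏ K ∈ F, form (β K)
  have hQ : evalAt z Q ≠ 0 := by
    rw [map_prod, Finset.prod_ne_zero_iff]
    intro K hK h0
    refine hz K hK ?_
    rw [← (hβ K hK).2]
    simpa using h0
  rw [eq_top_iff]
  intro y _
  obtain ⟨v, rfl⟩ := hα y
  let D := SymmetricAlgebra.derivationOfDual (Module.Dual.eval k V v)
  have hD : Q • D ∈ logDer (F : Set (Submodule k V)) := by
    intro K hK γ hγ
    rw [Ideal.mem_span_singleton]
    refine form_dvd_of_ker_eq (hγ.trans (hβ K hK).2.symm) (hβ K hK).1 ?_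
    rw [Derivation.smul_apply, smul_eq_mul]
    exact (Finset.dvd_prod_of_mem _ hK).mul_right _
  let f := θ.repr ⟨Q • D, hD⟩
  have hsum : Q • D = ∑ i, f i • (θ i : Derivation k (Sym k V) (Sym k V)) := by
    have := congrArg (logDer (F : Set (Submodule k V))).subtype (θ.sum_repr ⟨Q • D, hD⟩)
    rw [map_sum] at this
    exact this.symm
  have hy : LinearMap.pi α v = (evalAt z Q)⁻¹ • ∑ i, evalAt z (f i) • fun j =>
      evalAt z ((θ i : Derivation k (Sym k V) (Sym k V)) (form (α j))) := by
    rw [eq_inv_smul_iff₀ hQ]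
    ext j
    have h := congrArg (evalAt z) (DFunLike.congr_fun hsum (form (α j)))
    rw [Derivation.smul_apply, smul_eq_mul, map_mul, SymmetricAlgebra.derivationOfDual_ι,
      AlgHom.commutes, ← Derivation.coeFnAddMonoidHom_apply, map_sum, Finset.sum_apply,
      map_sum] at h
    simpa using h
  rw [hy]
  exact Submodule.smul_mem _ _ (Submodule.sum_mem _ fun i _ =>
    Submodule.smul_mem _ _ (Submodule.subset_span ⟨i, rfl⟩))

/-! ### Base changes and reordering of exponents. -/

/-- A scalar change of basis bringing a matrix `C` whose rows span to the form with an identity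
block in the rows `u j` and zeros elsewhere. -/
theorem exists_basis_change {R M ι κ : Type*} [CommRing R] [Nontrivial R] [Algebra k R]
    [AddCommGroup M] [Module R M] [Module k M] [IsScalarTower k R M] [Fintype ι] [DecidableEq ι]
    [Fintype κ] [DecidableEq κ]
    (θ : Module.Basis ι R M) (C : ι → κ → k) (hC : Submodule.span k (Set.range C) = ⊤) :
    ∃ (u : κ → ι) (θ' : Module.Basis ι R M) (G : ι → ι → k),
      Function.Injective u ∧ (∀ j, C (u j) ≠ 0) ∧ (∀ i, θ' i = ∑ t, G i t • θ t) ∧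
      (∀ i t, G i t ≠ 0 → t = i ∨ (C t ≠ 0 ∧ C i ≠ 0)) ∧
      ∀ i j, ∑ t, G i t * C t j = if i = u j then 1 else 0 := by
  obtain ⟨κ', a, ha, hspan, hli⟩ := exists_linearIndependent' k C
  let B' := Module.Basis.mk hli (by rw [hspan, hC])
  let E := B'.indexEquiv (Pi.basisFun k κ)
  let B := B'.reindex E
  let u : κ → ι := a ∘ E.symm
  have hu : Function.Injective u := ha.comp E.symm.injective
  have hB : ∀ j, B j = C (u j) := fun j => by simp [B, B', u]
  have hCu : ∀ j, C (u j) ≠ 0 := fun j => hB j ▸ B.ne_zero j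
  let L : (ι → k) →ₗ[k] (κ → k) := Fintype.linearCombination k C
  -- A section of `L` supported on the chosen rows.
  let T : (κ → k) →ₗ[k] (ι → k) := B.constr k fun j => Pi.single (u j) 1
  have hT : ∀ j, T (C (u j)) = Pi.single (u j) 1 := fun j => by
    rw [← hB]; exact B.constr_basis k _ j
  have hLe : ∀ i, L (Pi.single i 1) = C i := fun i => by
    simp [L, Fintype.linearCombination_apply_single]
  have hLT : ∀ y, L (T y) = y := fun y => by
    have : L ∘ₗ T = LinearMap.id := B.ext fun j => by
      rw [LinearMap.comp_apply, hB, hT, hLe, LinearMap.id_apply]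
    exact LinearMap.congr_fun this y
  have hTsupp : ∀ y t, T y t ≠ 0 → C t ≠ 0 := fun y t h h0 => h <| by
    have : LinearMap.proj t ∘ₗ T = 0 := B.ext fun j => by
      rw [LinearMap.comp_apply, hB, hT, LinearMap.proj_apply, LinearMap.zero_apply,
        Pi.single_eq_of_ne]
      rintro rfl
      exact hCu j h0
    exact LinearMap.congr_fun this y
  -- Row `u j` is a preimage of the `j`-th unit vector under `L`; any other row is corrected by
  -- chosen rows so that `L` kills it.
  let G : ι → ι → k := fun i =>
    if h : ∃ j, u j = i then T (Pi.single h.choose 1) else Pi.single i 1 - T (C i)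
  have hGu : ∀ j, G (u j) = T (Pi.single j 1) := fun j => by
    have h : ∃ j', u j' = u j := ⟨j, rfl⟩
    simp only [G, dif_pos h]
    rw [hu h.choose_spec]
  have hGn : ∀ i, (¬ ∃ j, u j = i) → G i = Pi.single i 1 - T (C i) := fun i h => by
    simp only [G, dif_neg h]
  have hTspan : ∀ y, T y ∈ Submodule.span k (Set.range G) := fun y => by
    rw [← (Pi.basisFun k κ).sum_repr y, map_sum]
    refine Submodule.sum_mem _ fun j _ => ?_
    rw [map_smul, Pi.basisFun_apply, ← hGu]
    exact Submodule.smul_mem _ _ (Submodule.subset_span ⟨_, rfl⟩)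
  have hespan : ∀ i, (Pi.single i 1 : ι → k) ∈ Submodule.span k (Set.range G) := fun i => by
    by_cases h : ∃ j, u j = i
    · obtain ⟨j, rfl⟩ := h
      rw [← hT]
      exact hTspan _
    · rw [← sub_add_cancel (Pi.single i 1) (T (C i)), ← hGn i h]
      exact add_mem (Submodule.subset_span ⟨i, rfl⟩) (hTspan _)
  let P : (ι → k) →ₗ[k] M := Fintype.linearCombination k θ
  have hPspan : ⊤ ≤ Submodule.span R (Set.range fun i => P (G i)) := by
    rw [← θ.span_eq, Submodule.span_le]
    rintro _ ⟨i, rfl⟩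
    have hle : Submodule.span k (Set.range G) ≤ Submodule.comap P
        ((Submodule.span R (Set.range fun i => P (G i))).restrictScalars k) := by
      rw [Submodule.span_le]
      rintro _ ⟨t, rfl⟩
      exact Submodule.subset_span ⟨t, rfl⟩
    have := hle (hespan i)
    simpa [P, Fintype.linearCombination_apply_single] using this
  refine ⟨u, basisOfTopLeSpanOfCardEqFinrank (fun i => P (G i)) hPspan
    (Module.finrank_eq_card_basis θ).symm, G, hu, hCu, fun i => ?_, fun i t h => ?_,
    fun i j => ?_⟩
  · rw [coe_basisOfTopLeSpanOfCardEqFinrank]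
    rfl
  · by_cases hi : ∃ j, u j = i
    · obtain ⟨j, rfl⟩ := hi
      rw [hGu] at h
      exact Or.inr ⟨hTsupp _ _ h, hCu j⟩
    · rw [hGn i hi] at h
      by_cases hti : t = i
      · exact Or.inl hti
      · rw [Pi.sub_apply, Pi.single_eq_of_ne hti, zero_sub, neg_ne_zero] at h
        refine Or.inr ⟨hTsupp _ _ h, fun h0 => h ?_⟩
        rw [h0, map_zero, Pi.zero_apply]
  · have hL : ∑ t, G i t * C t j = L (G i) j := by
      simp [L, Fintype.linearCombination_apply]
    rw [hL]
    by_cases hi : ∃ j', u j' = i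
    · obtain ⟨j', rfl⟩ := hi
      rw [hGu, hLT, Pi.single_apply]
      simp [hu.eq_iff, eq_comm]
    · rw [hGn i hi, map_sub, hLe, hLT, sub_self, if_neg fun h => hi ⟨j, h.symm⟩, Pi.zero_apply]

/-- If `N ≤ P` and `P` has a basis `θ`, and `N` consists of the elements whose `i`-th coordinate is
divisible by `s i`, then the `s i • θ i` form a basis of `N`. -/
theorem exists_basis_smul {R M ι : Type*} [CommRing R] [IsDomain R] [AddCommGroup M] [Module R M]
    [Fintype ι] {P N : Submodule R M} (hNP : N ≤ P) (θ : Module.Basis ι R P) {s : ι → R}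
    (hs : ∀ i, s i ≠ 0) (hmem : ∀ i, s i • (θ i : M) ∈ N)
    (hdvd : ∀ x (hx : x ∈ N), ∀ i, s i ∣ θ.repr ⟨x, hNP hx⟩ i) :
    ∃ η : Module.Basis ι R N, ∀ i, (η i : M) = s i • (θ i : M) := by
  let v : ι → N := fun i => ⟨s i • (θ i : M), hmem i⟩
  have hli : LinearIndependent R v := by
    rw [Fintype.linearIndependent_iff]
    intro g hg i
    have h1 : ∑ i, (g i * s i) • θ i = 0 := by
      apply Subtype.ext
      have := congrArg Subtype.val hg
      simpa [v, mul_smul] using this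
    exact (mul_eq_zero.1 (Fintype.linearIndependent_iff.1 θ.linearIndependent _ h1 i)).resolve_right
      (hs i)
  have hsp : ⊤ ≤ Submodule.span R (Set.range v) := by
    rintro ⟨x, hx⟩ -
    choose g hg using hdvd x hx
    have : (⟨x, hx⟩ : N) = ∑ i, g i • v i := by
      apply Subtype.ext
      have h := congrArg Subtype.val (θ.sum_repr ⟨x, hNP hx⟩)
      simp only [hg, mul_comm (s _), mul_smul] at h
      simpa [v] using h.symm
    rw [this]
    exact Submodule.sum_mem _ fun i _ => Submodule.smul_mem _ _ (Submodule.subset_span ⟨i, rfl⟩)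
  exact ⟨Module.Basis.mk hli hsp, fun i => by simp [v]⟩

/-- The last indices of a monotone family carry its largest value. -/
theorem eq_of_monotone_of_sub_le {l d q : ℕ} {e : Fin l → ℕ} (he : Monotone e)
    (hd : ∀ i, e i ≤ d) (hq : q ≤ {i | e i = d}.ncard) {i : Fin l} (hi : l - q ≤ (i : ℕ)) :
    e i = d := by
  by_contra hne
  have hlt : e i < d := lt_of_le_of_ne (hd i) hne
  have hsub : {i | e i = d} ⊆ (Finset.Ioi i : Set (Fin l)) := fun t ht => by
    rw [Finset.coe_Ioi, Set.mem_Ioi]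
    by_contra hti
    exact absurd (he (not_lt.1 hti)) (by rw [ht]; exact not_le.2 hlt)
  have hcard := Set.ncard_le_ncard hsub (Finset.finite_toSet _)
  rw [Set.ncard_coe_finset, Fin.card_Ioi] at hcard
  have := i.2
  omega

/-- Any `q` indices carrying the largest value of a monotone family can be moved to the end
without changing the family. -/
theorem exists_perm_of_monotone {l d q : ℕ} {e : Fin l → ℕ} (he : Monotone e)
    (hd : ∀ i, e i ≤ d) {u : Fin q → Fin l} (hu : Function.Injective u) (hud : ∀ j, e (u j) = d) :
    q ≤ {i | e i = d}.ncard ∧ ∃ σ : Equiv.Perm (Fin l), ∀ i, e (σ i) = e i ∧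
      (l - q ≤ (σ i : ℕ) ↔ i ∈ Set.range u) := by
  have hq : q ≤ {i | e i = d}.ncard := by
    have := Set.ncard_le_ncard (s := Set.range u) (t := {i | e i = d})
      (by rintro _ ⟨j, rfl⟩; exact hud j) (Set.toFinite _)
    rwa [← Set.image_univ, Set.ncard_image_of_injective _ hu, Set.ncard_univ, Nat.card_fin] at this
  have hql : q ≤ l := by simpa using Fintype.card_le_of_injective u hu
  let w : Fin q → {i // e i = d} := fun j => ⟨⟨l - q + j, by omega⟩,
    eq_of_monotone_of_sub_le he hd hq (by simp)⟩
  have hw : Function.Injective w := fun j j' h => by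
    simp only [w, Subtype.mk.injEq, Fin.mk.injEq] at h
    omega
  -- Permuting only the indices with `e i = d` leaves `e` unchanged.
  obtain ⟨τ, hτ⟩ := Equiv.Perm.exists_extending_pair
    (fun j => (⟨u j, hud j⟩ : {i // e i = d})) w (fun j j' h => hu (congrArg Subtype.val h)) hw
  have hσu : ∀ j, Equiv.Perm.ofSubtype τ (u j) = (w j : Fin l) := fun j => by
    rw [Equiv.Perm.ofSubtype_apply_of_mem τ (hud j), hτ]
  refine ⟨hq, Equiv.Perm.ofSubtype τ, fun i => ⟨?_, fun h => ?_, ?_⟩⟩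
  · by_cases hi : e i = d
    · rw [hi]
      exact (Equiv.Perm.ofSubtype_apply_mem_iff_mem τ i).2 hi
    · rw [Equiv.Perm.ofSubtype_apply_of_not_mem τ hi]
  · have hlt := (Equiv.Perm.ofSubtype τ i).2
    refine ⟨⟨(Equiv.Perm.ofSubtype τ i : ℕ) - (l - q), by omega⟩,
      (Equiv.Perm.ofSubtype τ).injective ?_⟩
    rw [hσu]
    ext
    simp only [w]
    omega
  · rintro ⟨j, rfl⟩
    rw [hσu]
    simp [w]

theorem surjective_pi_of_finrank_quotient [FiniteDimensional k V] {q : ℕ}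
    {α : Fin q → Module.Dual k V}
    (h : Module.finrank k (V ⧸ (⨅ j, LinearMap.ker (α j))) = q) :
    Function.Surjective (LinearMap.pi α) := by
  rw [← LinearMap.range_eq_top]
  apply Submodule.eq_top_of_finrank_eq
  rw [← LinearMap.ker_pi] at h
  rw [← (LinearMap.pi α).quotKerEquivRange.finrank_eq, h, Module.finrank_fin_fun]

/-! ### The enlarged arrangement and the theorem. -/

/-- Adding hyperplanes `ker (α j)` to an arrangement, given a basis of its module of logarithmic
derivations that is adapted to the `α j`. -/
theorem exists_basis_logDer_union {A : Set (Submodule k V)} {ι κ : Type*} [Fintype ι]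
    [DecidableEq ι]
    (θ : Module.Basis ι (Sym k V) (logDer A)) {α : κ → Module.Dual k V} (hα : ∀ j, α j ≠ 0)
    {u : κ → ι} (hu : Function.Injective u) {b : κ → Sym k V} (hb : ∀ j, ¬ form (α j) ∣ b j)
    (hθ : ∀ i j, form (α j) ∣ (θ i : Derivation k (Sym k V) (Sym k V)) (form (α j)) -
      if i = u j then b j else 0) :
    ∃ η : Module.Basis ι (Sym k V)
        (logDer (A ∪ Set.range fun j => LinearMap.ker (α j))),
      (∀ j, (η (u j) : Derivation k (Sym k V) (Sym k V)) = form (α j) • (θ (u j)).1) ∧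
      ∀ i, i ∉ Set.range u → (η i : Derivation k (Sym k V) (Sym k V)) = (θ i).1 := by
  let s : ι → Sym k V := Function.extend u (fun j => form (α j)) 1
  have hsu : ∀ j, s (u j) = form (α j) := fun j => hu.extend_apply _ _ j
  have hsn : ∀ i, i ∉ Set.range u → s i = 1 := fun i hi => Function.extend_apply' _ _ i hi
  have hle : logDer (A ∪ Set.range fun j => LinearMap.ker (α j)) ≤ logDer A :=
    fun θ hθ H hH => hθ H (Or.inl hH)
  suffices h : ∃ η : Module.Basis ι (Sym k V)
      (logDer (A ∪ Set.range fun j => LinearMap.ker (α j))),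
      ∀ i, (η i : Derivation k (Sym k V) (Sym k V)) = s i • (θ i).1 by
    obtain ⟨η, hη⟩ := h
    exact ⟨η, fun j => by rw [hη, hsu], fun i hi => by rw [hη, hsn i hi, one_smul]⟩
  refine exists_basis_smul hle θ (fun i => ?_) (fun i => ?_) (fun x hx i => ?_)
  · by_cases hi : i ∈ Set.range u
    · obtain ⟨j, rfl⟩ := hi
      rw [hsu]
      exact (SymmetricAlgebra.prime_ι (hα j)).ne_zero
    · rw [hsn i hi]
      exact one_ne_zero
  · rintro H (hH | ⟨j, rfl⟩) β hβ
    · exact (logDer A).smul_mem (s i) (θ i).2 H hH β hβ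
    · rw [Ideal.mem_span_singleton]
      refine form_dvd_of_ker_eq hβ (hα j) ?_
      rw [Derivation.smul_apply, smul_eq_mul]
      by_cases hij : i = u j
      · rw [hij, hsu]
        exact dvd_mul_right _ _
      · have := hθ i j
        rw [if_neg hij, sub_zero] at this
        exact this.mul_left _
  · by_cases hi : i ∈ Set.range u
    · obtain ⟨j, rfl⟩ := hi
      rw [hsu]
      let f := θ.repr ⟨x, hle hx⟩
      have hsum : x (form (α j)) = ∑ i, f i * (θ i).1 (form (α j)) := by
        have h := congrArg (logDer A).subtype (θ.sum_repr ⟨x, hle hx⟩)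
        have h' := congrArg (fun D : Derivation k (Sym k V) (Sym k V) =>
          Derivation.coeFnAddMonoidHom D (form (α j))) h
        simp only [map_sum, Finset.sum_apply] at h'
        exact h'.symm
      have hx' : form (α j) ∣ x (form (α j)) :=
        form_dvd_of_mem_logDer hx (Or.inr ⟨j, rfl⟩)
      -- Modulo `α j`, only the basis element `u j` contributes.
      have hdiff : form (α j) ∣ x (form (α j)) - f (u j) * b j := by
        have : x (form (α j)) - f (u j) * b j =
            ∑ i, f i * ((θ i).1 (form (α j)) - if i = u j then b j else 0) := by
          simp [hsum, mul_sub]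
        rw [this]
        exact Finset.dvd_sum fun i _ => (hθ i j).mul_left _
      have hfb : form (α j) ∣ f (u j) * b j := by
        simpa using dvd_sub hx' hdiff
      exact ((SymmetricAlgebra.prime_ι (hα j)).dvd_or_dvd hfb).resolve_right (hb j)
    · rw [hsn i hi]
      exact one_dvd _

end HyperplaneArrangement

theorem theorem3p1 {k V : Type*} [Field k] [AddCommGroup V] [Module k V] [FiniteDimensional k V]
    (l : ℕ) (hl : Module.finrank k V = l)
    (A' : Set (Submodule k V)) (hA' : HyperplaneArrangement.IsArrangement A')
    (e : Fin l → ℕ) (he : Monotone e)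
    (hfree : HyperplaneArrangement.IsFreeWithExponents A' e)
    (d p : ℕ) (hd : IsGreatest (Set.range e) d) (hp : p = {i : Fin l | e i = d}.ncard)
    (q : ℕ) (H : Fin q → Submodule k V)
    (hH : ∀ j, HyperplaneArrangement.IsHyperplane (H j)) (hHA' : ∀ j, H j ∉ A')
    (h1 : Module.finrank k (V ⧸ (⨅ j, H j)) = q)
    (h2 : ¬ (((⨅ j, H j : Submodule k V) : Set V) ⊆ ⋃ K ∈ A', (K : Set V)))
    (h3 : ∀ j, (A'.ncard : ℤ)
      - ((HyperplaneArrangement.restriction (A' ∪ {H j}) (H j)).ncard : ℤ) = d) :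
    q ≤ p ∧
      HyperplaneArrangement.IsFreeWithExponents (A' ∪ Set.range H)
        (fun i : Fin l => if (i : ℕ) < l - q then e i else d + 1) := by
  open HyperplaneArrangement in
  obtain ⟨z, hzX, hzA⟩ := Set.not_subset.1 h2
  have hzA' : ∀ K ∈ A', z ∉ K := fun K hK hz => hzA (Set.mem_biUnion hK hz)
  choose α hα hαH using fun j => (hH j).exists_ker_eq
  obtain rfl : H = fun j => LinearMap.ker (α j) := funext fun j => (hαH j).symm
  have hed : ∀ i, e i ≤ d := fun i => hd.2 ⟨i, rfl⟩
  have hαz : ∀ j, α j z = 0 := fun j => (Submodule.mem_iInf _).1 hzX j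
  obtain ⟨θ, hθ⟩ := hfree
  let C : Fin l → Fin q → k := fun i j => evalAt z ((θ i).1 (form (α j)))
  have hC : Submodule.span k (Set.range C) = ⊤ :=
    span_evalAt_eq_top hA' hzA' θ (surjective_pi_of_finrank_quotient h1)
  choose b hb using fun j => exists_form_dvd_sub_smul hA' (hHA' j) (h3 j)
  have heval : ∀ j f, form (α j) ∣ f → evalAt z f = 0 := by
    rintro j _ ⟨g, rfl⟩
    rw [map_mul, evalAt_form, hαz, zero_mul]
  have hClt : ∀ i, e i < d → ∀ j, form (α j) ∣ (θ i).1 (form (α j)) := fun i hi j =>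
    (hb j _ (θ i).2 _ (hθ i)).1 hi
  have hCne : ∀ i, C i ≠ 0 → e i = d := fun i hi => by
    by_contra hne
    exact hi (funext fun j => heval j _ (hClt i (lt_of_le_of_ne (hed i) hne) j))
  -- Otherwise column `j` of `C` vanishes and the rows cannot span.
  have hbz : ∀ j, evalAt z (b j) ≠ 0 := by
    intro j h0
    have hle : Submodule.span k (Set.range C) ≤ LinearMap.ker (LinearMap.proj j) := by
      rw [Submodule.span_le]
      rintro _ ⟨i, rfl⟩
      change C i j = 0
      rcases (hed i).lt_or_eq with hi | hi
      · exact heval j _ (hClt i hi j)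
      · obtain ⟨c, hc⟩ := (hb j _ (θ i).2 _ (hθ i)).2 hi
        have := heval j _ hc
        rwa [map_sub, map_smul, h0, smul_zero, sub_zero] at this
    rw [hC] at hle
    have : (Pi.single j 1 : Fin q → k) ∈ LinearMap.ker (LinearMap.proj j) :=
      hle Submodule.mem_top
    simp at this
  -- Normalized to value 1 at `z`, so that the scalar modulo `α j` is exactly `C i j`.
  let b' : Fin q → Sym k V := fun j => (evalAt z (b j))⁻¹ • b j
  have hcongr : ∀ i j, form (α j) ∣ (θ i).1 (form (α j)) - C i j • b' j := by
    intro i j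
    rcases (hed i).lt_or_eq with hi | hi
    · have hdvd := hClt i hi j
      rw [show C i j = 0 from heval j _ hdvd, zero_smul, sub_zero]
      exact hdvd
    · obtain ⟨c, hc⟩ := (hb j _ (θ i).2 _ (hθ i)).2 hi
      have hz := heval j _ hc
      rw [map_sub, map_smul, sub_eq_zero, smul_eq_mul] at hz
      rwa [show C i j = c * evalAt z (b j) from hz, smul_smul, mul_assoc,
        mul_inv_cancel₀ (hbz j), mul_one]
  obtain ⟨u, θ', G, hu, hCu, hθ', hG, hGC⟩ :=
    exists_basis_change (R := Sym k V) (M := logDer A') θ C hC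
  have hθ'val : ∀ i β, (θ' i).1 (form β) = ∑ t, G i t • (θ t).1 (form β) := by
    intro i β
    have h := congrArg (logDer A').subtype (hθ' i)
    have h' := congrArg (fun D : Derivation k (Sym k V) (Sym k V) =>
      Derivation.coeFnAddMonoidHom D (form β)) h
    simp only [map_sum, Finset.sum_apply] at h'
    exact h'
  have hhom : ∀ i, IsHomogeneousOfDegree (θ' i).1 (e i) := by
    intro i β
    rw [hθ'val]
    refine Submodule.sum_mem _ fun t _ => ?_
    by_cases h0 : G i t = 0
    · rw [h0, zero_smul]
      exact Submodule.zero_mem _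
    · refine Submodule.smul_mem _ _ ?_
      -- Only basis elements with nonzero rows of `C` are mixed, and these all have degree `d`.
      have het : e t = e i := by
        rcases hG i t h0 with rfl | ⟨ht, hi⟩
        · rfl
        · rw [hCne t ht, hCne i hi]
      exact het ▸ hθ t β
  have hadapt : ∀ i j, form (α j) ∣ (θ' i).1 (form (α j)) - if i = u j then b' j else 0 := by
    intro i j
    have : (θ' i).1 (form (α j)) - (if i = u j then b' j else 0) =
        ∑ t, G i t • ((θ t).1 (form (α j)) - C t j • b' j) := by
      simp only [smul_sub, Finset.sum_sub_distrib, ← hθ'val, smul_smul, ← Finset.sum_smul, hGC,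
        ite_smul, one_smul, zero_smul]
    rw [this]
    refine Finset.dvd_sum fun t _ => ?_
    rw [Algebra.smul_def]
    exact (hcongr t j).mul_left _
  have hb'dvd : ∀ j, ¬ form (α j) ∣ b' j := fun j h => by
    have := heval j _ h
    rw [map_smul, smul_eq_mul, inv_mul_cancel₀ (hbz j)] at this
    exact one_ne_zero this
  obtain ⟨η, hηu, hηn⟩ := exists_basis_logDer_union θ' hα hu hb'dvd hadapt
  obtain ⟨hq, σ, hσ⟩ := exists_perm_of_monotone he hed hu fun j => hCne _ (hCu j)
  refine ⟨hp ▸ hq, η.reindex σ, fun i => ?_⟩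
  obtain ⟨i, rfl⟩ := σ.surjective i
  dsimp only
  rw [Module.Basis.reindex_apply, Equiv.symm_apply_apply]
  by_cases hi : i ∈ Set.range u
  · rw [if_neg (not_lt.2 ((hσ i).2.2 hi))]
    obtain ⟨j, rfl⟩ := hi
    rw [hηu, add_comm]
    intro β
    have := hhom (u j) β
    rw [hCne _ (hCu j)] at this
    rw [Derivation.smul_apply, smul_eq_mul, homogeneousPart, pow_add, pow_one]
    exact Submodule.mul_mem_mul (LinearMap.mem_range_self _ _) this
  · rw [if_pos (not_le.1 fun h => hi ((hσ i).2.1 h)), (hσ i).1, hηn i hi]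
    exact hhom i
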